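/- Let $\mathcal{H}$ be a complex Hilbert space; a contraction is a bounded linear operator $T$ on $\mathcal{H}$ with $\|T\|\le 1$, and a coisometry is an operator whose adjoint is an isometry. For a bounded operator $A$ write $\operatorname{Re} A=\tfrac12(A+A^*)$. A contraction $T$ is *Harnack dominated* by a contraction $T'$ if there is a constant $c\ge 1$ such that $\operatorname{Re} p(T)\le c\,\operatorname{Re} p(T')$ (as self-adjoint operators) for every complex polynomial $p$ with $\operatorname{Re} p(z)\ge 0$ for all $|z|\le 1$. A contraction $T$ is *minimal* for Harnack domination if every contraction $T'$ on $\mathcal{H}$ that is Harnack dominated by $T$ equals $T$. A contraction on $\mathcal{H}$ is minimal for Harnack domination if and only if it is an isometry or a coisometry. Moreover, if $T'$ is an isometry on $\mathcal{H}$ and $T$ is a contraction on $\mathcal{H}$ that is Harnack dominated by $T'$, then $T=T'$. -/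

import Mathlib

open scoped ComplexStarModule

/-- `T` is Harnack dominated by `T'`: there is a constant `c ≥ 1` such that
`Re p(T) ≤ c Re p(T')` in the Loewner order for every complex polynomial `p` whose real part is
nonnegative on the closed unit disk. Here `Re A = (A + A*) / 2`. -/
def HarnackDominated {H : Type*} [NormedAddCommGroup H] [InnerProductSpace ℂ H] [CompleteSpace H]
    (T T' : H →L[ℂ] H) : Prop :=
  ∃ c : ℝ, 1 ≤ c ∧ ∀ p : Polynomial ℂ, (∀ z : ℂ, ‖z‖ ≤ 1 → 0 ≤ (p.eval z).re) →
    (ℜ (Polynomial.aeval T p) : H →L[ℂ] H) ≤ c • (ℜ (Polynomial.aeval T' p) : H →L[ℂ] H)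

/-- A contraction `T` is minimal for Harnack domination if the only contraction that is
Harnack dominated by `T` is `T` itself. -/
def IsHarnackMinimal {H : Type*} [NormedAddCommGroup H] [InnerProductSpace ℂ H] [CompleteSpace H]
    (T : H →L[ℂ] H) : Prop :=
  ∀ T' : H →L[ℂ] H, ‖T'‖ ≤ 1 → HarnackDominated T' T → T' = T

open Polynomial Finset ComplexConjugate

/-! Everything is tested on Fejér kernels. With s_k = ∑_{j≤k} (ηT)^j x, the n-th Fejér form of T at
x is the energy ‖s_n‖² + ∑_{k<n} (‖s_k‖² - ‖T s_k‖²). Averaging these forms over roots of unity with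
weights Re p gives n Re p(T) + O(1), so a uniform bound between Fejér forms yields Harnack
domination (`harnackDominated_of_fejerPolynomial_le`). Conversely, domination bounds the form ‖x‖² +
‖y‖² + 2 Re⟨x, Ty⟩ (`HarnackDominated.toeplitz_two_le`); for an isometry or coisometry T' the
dominating form has enough zeros to force T = T'. If T is neither, both defects 1 - T*T and 1 - TT*
are nonzero, and T + (1 - TT*)X(1 - T*T) with X small of rank one is a different contraction. The
energies of the two orbits are comparable (`re_inner_aeval_fejerPolynomial_le`), so it is dominated
by T. -/

/-! ### Fejér averaging over roots of unity -/

/-- Orthogonality of the characters of the group of `N`-th roots of unity. -/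
theorem IsPrimitiveRoot.sum_pow_mul_inv_pow {N : ℕ} {ζ : ℂ} (hζ : IsPrimitiveRoot ζ N)
    {k j : ℕ} (hk : k < N) (hj : j < N) :
    ∑ i ∈ range N, (ζ ^ i) ^ k * ((ζ ^ i)⁻¹) ^ j = if k = j then (N : ℂ) else 0 := by
  have h0 : ζ ≠ 0 := hζ.ne_zero (by omega)
  have hterm : ∀ i : ℕ, (ζ ^ i) ^ k * ((ζ ^ i)⁻¹) ^ j = (ζ ^ k * (ζ ^ j)⁻¹) ^ i := by
    intro i
    rw [mul_pow, inv_pow, inv_pow, ← pow_mul, ← pow_mul, ← pow_mul, ← pow_mul, mul_comm i k,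
      mul_comm i j]
  simp_rw [hterm]
  split_ifs with h
  · subst h
    simp [mul_inv_cancel₀ (pow_ne_zero k h0)]
  · have hw : ζ ^ k * (ζ ^ j)⁻¹ ≠ 1 := by
      intro hw
      rw [mul_inv_eq_one₀ (pow_ne_zero j h0)] at hw
      exact h (hζ.pow_inj hk hj hw)
    rw [geom_sum_eq hw, mul_pow, inv_pow, ← pow_mul, ← pow_mul, mul_comm k, mul_comm j, pow_mul,
      pow_mul, hζ.pow_eq_one]
    simp

/-- Coefficients of the (unnormalised) analytic Fejér kernel. -/
noncomputable def fejerCoeff (n j : ℕ) : ℂ := if j = 0 then n + 1 else 2 * (n + 1 - j)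

/-- The analytic Fejér kernel `∑ (2 ∑ (η z) ^ j - 1)`. -/
noncomputable def fejerPolynomial (n : ℕ) (η : ℂ) : ℂ[X] :=
  ∑ m ∈ range (n + 1), (2 * ∑ j ∈ range (m + 1), (C η * X) ^ j - 1)

theorem sum_partial_sums_eq_sum_fejerCoeff (n : ℕ) (t : ℕ → ℂ) :
    ∑ m ∈ range (n + 1), (2 * ∑ j ∈ range (m + 1), t j - t 0) =
      ∑ j ∈ range (n + 1), fejerCoeff n j * t j := by
  induction n with
  | zero => simp [fejerCoeff]; ring
  | succ n ih =>
    -- The added coefficient `fejerCoeff n (n + 1)` is zero.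
    have h1 : ∑ j ∈ range (n + 1), fejerCoeff n j * t j
        = ∑ j ∈ range (n + 1 + 1), fejerCoeff n j * t j := by
      rw [sum_range_succ _ (n + 1)]
      simp [fejerCoeff]
    have h2 : 2 * ∑ j ∈ range (n + 1 + 1), t j - t 0 =
        ∑ j ∈ range (n + 1 + 1), (if j = 0 then 1 else 2) * t j := by
      rw [sum_range_succ' _ (n + 1), sum_range_succ' _ (n + 1)]
      simp [mul_add, mul_sum]
      ring
    rw [sum_range_succ _ (n + 1), ih, h1, h2, ← sum_add_distrib]
    refine sum_congr rfl fun j _ => ?_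
    unfold fejerCoeff
    split_ifs <;> push_cast <;> ring

theorem IsPrimitiveRoot.sum_pow_mul_fejer {N n k : ℕ} {ζ : ℂ} (hζ : IsPrimitiveRoot ζ N)
    (hk : k ≤ n) (hn : n < N) (t : ℕ → ℂ) :
    ∑ i ∈ range N, (ζ ^ i) ^ k * ∑ j ∈ range (n + 1), fejerCoeff n j * (((ζ ^ i)⁻¹) ^ j * t j) =
      N * (fejerCoeff n k * t k) := by
  simp_rw [mul_sum]
  rw [sum_comm]
  have : ∀ j ∈ range (n + 1),
      ∑ i ∈ range N, (ζ ^ i) ^ k * (fejerCoeff n j * (((ζ ^ i)⁻¹) ^ j * t j)) =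
        if k = j then N * (fejerCoeff n j * t j) else 0 := by
    intro j hj
    rw [mem_range] at hj
    have := hζ.sum_pow_mul_inv_pow (k := k) (j := j) (by omega) (by omega)
    calc _ = (∑ i ∈ range N, (ζ ^ i) ^ k * ((ζ ^ i)⁻¹) ^ j) * (fejerCoeff n j * t j) := by
          rw [sum_mul]
          exact sum_congr rfl fun i _ => by ring
      _ = _ := by rw [this]; split_ifs <;> simp
  rw [sum_congr rfl this, sum_ite_eq, if_pos (mem_range.2 (by omega))]

/-- Only the frequencies -(k + j) occur, with k + j < N, so there is no aliasing and only frequency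
0 survives. -/
theorem IsPrimitiveRoot.sum_inv_pow_mul_fejer {N n k : ℕ} {ζ : ℂ} (hζ : IsPrimitiveRoot ζ N)
    (hn : k + n < N) (t : ℕ → ℂ) :
    ∑ i ∈ range N, ((ζ ^ i)⁻¹) ^ k *
        ∑ j ∈ range (n + 1), fejerCoeff n j * (((ζ ^ i)⁻¹) ^ j * t j) =
      if k = 0 then N * ((n + 1) * t 0) else 0 := by
  rcases Nat.eq_zero_or_pos k with rfl | hk
  · simpa [fejerCoeff] using hζ.sum_pow_mul_fejer (Nat.zero_le n) (by omega) t
  · rw [if_neg hk.ne']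
    simp_rw [mul_sum]
    rw [sum_comm]
    refine sum_eq_zero fun j hj => ?_
    rw [mem_range] at hj
    have := hζ.sum_pow_mul_inv_pow (k := 0) (j := k + j) (by omega) (by omega)
    rw [if_neg (by omega)] at this
    calc _ = (∑ i ∈ range N, (ζ ^ i) ^ 0 * ((ζ ^ i)⁻¹) ^ (k + j)) * (fejerCoeff n j * t j) := by
          rw [sum_mul]
          exact sum_congr rfl fun i _ => by ring
      _ = 0 := by rw [this, zero_mul]

theorem Complex.conj_eq_inv_of_norm_eq_one {w : ℂ} (hw : ‖w‖ = 1) : conj w = w⁻¹ := by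
  rw [Complex.inv_def, Complex.normSq_eq_norm_sq, hw]
  simp

/-- Fejér summation of a polynomial, by averaging over roots of unity. -/
theorem IsPrimitiveRoot.sum_re_eval_mul_re_fejer {N n : ℕ} {ζ : ℂ} (hζ : IsPrimitiveRoot ζ N)
    (p : ℂ[X]) (hp : p.natDegree ≤ n) (hn : p.natDegree + n < N) (t : ℕ → ℂ)
    (ht : (t 0).im = 0) :
    ∑ i ∈ range N, (p.eval (ζ ^ i)).re *
        (∑ j ∈ range (n + 1), fejerCoeff n j * (((ζ ^ i)⁻¹) ^ j * t j)).re =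
      N * (∑ k ∈ range (p.natDegree + 1), p.coeff k * ((n + 1 - k) * t k)).re := by
  set F : ℕ → ℂ := fun i => ∑ j ∈ range (n + 1), fejerCoeff n j * (((ζ ^ i)⁻¹) ^ j * t j)
  have hnorm : ∀ i, ‖ζ ^ i‖ = 1 := by
    intro i
    rw [norm_pow, hζ.norm'_eq_one (by omega), one_pow]
  have h1 : ∑ i ∈ range N, p.eval (ζ ^ i) * F i =
      ∑ k ∈ range (p.natDegree + 1), p.coeff k * (N * (fejerCoeff n k * t k)) := by
    simp_rw [Polynomial.eval_eq_sum_range, sum_mul]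
    rw [sum_comm]
    refine sum_congr rfl fun k hk => ?_
    rw [mem_range] at hk
    rw [← hζ.sum_pow_mul_fejer (k := k) (by omega) (by omega) t, mul_sum]
    exact sum_congr rfl fun i _ => by simp only [F]; ring
  have h2 : ∑ i ∈ range N, conj (p.eval (ζ ^ i)) * F i =
      conj (p.coeff 0) * (N * ((n + 1) * t 0)) := by
    simp_rw [Polynomial.eval_eq_sum_range, map_sum, map_mul, map_pow,
      sum_mul]
    rw [sum_comm]
    have : ∀ k ∈ range (p.natDegree + 1),
        ∑ i ∈ range N, conj (p.coeff k) * (conj ζ ^ i) ^ k * F i =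
          if k = 0 then conj (p.coeff 0) * (N * ((n + 1) * t 0)) else 0 := by
      intro k hk
      rw [mem_range] at hk
      have := hζ.sum_inv_pow_mul_fejer (n := n) (k := k) (by omega) t
      calc _ = conj (p.coeff k) * ∑ i ∈ range N, ((ζ ^ i)⁻¹) ^ k * F i := by
            rw [mul_sum]
            refine sum_congr rfl fun i _ => ?_
            rw [← map_pow, Complex.conj_eq_inv_of_norm_eq_one (hnorm i), mul_assoc]
        _ = _ := by
            rw [this]
            split_ifs with h
            · rw [h]
            · simp
    rw [sum_congr rfl this, sum_ite_eq', if_pos (by simp)]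
  -- Halving removes the factor 2 from the positive frequencies; the conjugate term contributes only
  -- at k = 0, where `t 0` being real makes it double the constant term.
  have h3 : ∀ i, (p.eval (ζ ^ i)).re * (F i).re =
      ((p.eval (ζ ^ i) * F i).re + (conj (p.eval (ζ ^ i)) * F i).re) / 2 := by
    intro i
    simp only [Complex.mul_re, Complex.conj_re, Complex.conj_im]
    ring
  change ∑ i ∈ range N, (p.eval (ζ ^ i)).re * (F i).re = _
  simp_rw [h3]
  rw [← sum_div, sum_add_distrib, ← Complex.re_sum, ← Complex.re_sum, h1, h2,
    sum_range_succ', sum_range_succ' (fun k => p.coeff k * (((n : ℂ) + 1 - k) * t k))]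
  have h4 : ∑ k ∈ range p.natDegree, p.coeff (k + 1) * (N * (fejerCoeff n (k + 1) * t (k + 1))) =
      ((2 * N : ℝ) : ℂ) * ∑ k ∈ range p.natDegree, p.coeff (k + 1) *
        ((n + 1 - ((k + 1 : ℕ) : ℂ)) * t (k + 1)) := by
    rw [mul_sum]
    refine sum_congr rfl fun k _ => ?_
    simp [fejerCoeff]
    ring
  rw [h4]
  simp [fejerCoeff, Complex.add_re, ht]
  ring

/-- Lower bounds along an affine progression force the slope to be nonnegative. -/
theorem nonneg_of_forall_natCast_mul_add_nonneg {x y : ℝ} {d : ℕ}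
    (h : ∀ n : ℕ, d ≤ n → 0 ≤ n * x + y) : 0 ≤ x := by
  by_contra! hx
  obtain ⟨n, hn⟩ := exists_nat_gt (y / -x)
  rw [div_lt_iff₀ (by linarith)] at hn
  have h1 := h (max n d) (le_max_right _ _)
  have h2 : (n : ℝ) ≤ ((max n d : ℕ) : ℝ) := by exact_mod_cast le_max_left n d
  nlinarith

/-! ### The energy identity and positivity of the Fejér kernel -/

section Energy

variable {E : Type*} [NormedAddCommGroup E] [InnerProductSpace ℂ E]

/-- The Fejér form as an energy of the recursion `s (k + 1) = h + f (s k)`. -/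
theorem sum_re_inner_two_smul_sub_eq_energy (f : E → E) (h : E) (s : ℕ → E) (h0 : s 0 = h)
    (hs : ∀ k, s (k + 1) = h + f (s k)) (n : ℕ) :
    ∑ m ∈ range (n + 1), (inner ℂ h ((2 : ℂ) • s m - h)).re =
      ‖s n‖ ^ 2 + ∑ k ∈ range n, (‖s k‖ ^ 2 - ‖f (s k)‖ ^ 2) := by
  have hself : (inner ℂ h h).re = ‖h‖ ^ 2 := by
    simpa using inner_self_eq_norm_sq (𝕜 := ℂ) h
  have hterm : ∀ y : E, (inner ℂ h ((2 : ℂ) • y - h)).re = 2 * (inner ℂ h y).re - ‖h‖ ^ 2 := by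
    intro y
    rw [inner_sub_right, inner_smul_right, Complex.sub_re, hself]
    simp
  simp_rw [hterm]
  induction n with
  | zero =>
    simp only [zero_add, sum_range_one, sum_range_zero, h0, hself]
    ring
  | succ n ih =>
    rw [sum_range_succ, ih, sum_range_succ _ n, hs n]
    have h1 := norm_add_sq (𝕜 := ℂ) h (f (s n))
    rw [h1, inner_add_right, Complex.add_re, hself, RCLike.re_eq_complex_re]
    ring

end Energy

/-- The energy identity on ℂ, for multiplication by ηz: every summand is ‖s_k‖²(1 - ‖z‖²) ≥ 0. -/
theorem eval_fejerPolynomial_re_nonneg (n : ℕ) {η z : ℂ} (hη : ‖η‖ = 1) (hz : ‖z‖ ≤ 1) :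
    0 ≤ ((fejerPolynomial n η).eval z).re := by
  have h := sum_re_inner_two_smul_sub_eq_energy (fun x : ℂ => η * z * x) 1
    (fun m => ∑ j ∈ range (m + 1), (η * z) ^ j) (by simp)
    (fun k => by
      rw [sum_range_succ', mul_sum, add_comm]
      simp [pow_succ'])  n
  have h2 : ((fejerPolynomial n η).eval z).re = ∑ m ∈ range (n + 1),
      (inner ℂ (1 : ℂ) ((2 : ℂ) • (∑ j ∈ range (m + 1), (η * z) ^ j) - 1)).re := by
    simp [fejerPolynomial, Polynomial.eval_finsetSum]
  rw [h2, h]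
  refine add_nonneg (by positivity) (sum_nonneg fun k _ => ?_)
  rw [norm_mul, norm_mul, hη, one_mul, mul_pow, sub_nonneg]
  exact mul_le_of_le_one_left (by positivity) (pow_le_one₀ (norm_nonneg _) hz)

/-! ### Fejér forms of operators -/

section Hilbert

variable {H : Type*} [NormedAddCommGroup H] [InnerProductSpace ℂ H]

theorem aeval_fejerPolynomial_apply (T : H →L[ℂ] H) (n : ℕ) (η : ℂ) (x : H) :
    aeval T (fejerPolynomial n η) x =
      ∑ m ∈ range (n + 1), ((2 : ℂ) • (∑ j ∈ range (m + 1), η ^ j • (T ^ j) x) - x) := by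
  have : aeval T (fejerPolynomial n η) =
      ∑ m ∈ range (n + 1), ((2 : ℂ) • (∑ j ∈ range (m + 1), η ^ j • T ^ j) - 1) := by
    simp only [fejerPolynomial, map_sum, map_sub, map_mul, map_pow, aeval_C, aeval_X, map_one,
      map_ofNat]
    refine sum_congr rfl fun m _ => ?_
    congr 1
    rw [ofNat_smul_eq_nsmul, two_mul, two_smul]
    simp only [Algebra.algebraMap_eq_smul_one, smul_one_mul, _root_.smul_pow]
  rw [this, _root_.sum_apply]
  refine sum_congr rfl fun m _ => ?_
  rw [_root_.sub_apply, _root_.smul_apply, _root_.sum_apply, one_apply_eq_self]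
  rfl

theorem inner_aeval_fejerPolynomial (T : H →L[ℂ] H) (n : ℕ) (η : ℂ) (x y : H) :
    inner ℂ x (aeval T (fejerPolynomial n η) y) =
      ∑ j ∈ range (n + 1), fejerCoeff n j * (η ^ j * inner ℂ x ((T ^ j) y)) := by
  rw [← sum_partial_sums_eq_sum_fejerCoeff n (fun j => η ^ j * inner ℂ x ((T ^ j) y)),
    aeval_fejerPolynomial_apply, inner_sum]
  simp [inner_sub_right, inner_smul_right, inner_sum]

/-- The orbit `∑_{j ≤ k} (η T) ^ j x`. -/
noncomputable def geomOrbit (T : H →L[ℂ] H) (η : ℂ) (x : H) (k : ℕ) : H :=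
  ∑ j ∈ range (k + 1), η ^ j • (T ^ j) x

theorem geomOrbit_zero (T : H →L[ℂ] H) (η : ℂ) (x : H) : geomOrbit T η x 0 = x := by
  simp [geomOrbit]

theorem geomOrbit_succ (T : H →L[ℂ] H) (η : ℂ) (x : H) (k : ℕ) :
    geomOrbit T η x (k + 1) = x + η • T (geomOrbit T η x k) := by
  rw [geomOrbit, sum_range_succ', add_comm, geomOrbit, map_sum, smul_sum]
  simp [pow_succ', mul_smul]

theorem re_inner_aeval_fejerPolynomial (T : H →L[ℂ] H) (n : ℕ) {η : ℂ} (hη : ‖η‖ = 1) (x : H) :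
    (inner ℂ x (aeval T (fejerPolynomial n η) x)).re = ‖geomOrbit T η x n‖ ^ 2 +
      ∑ k ∈ range n, (‖geomOrbit T η x k‖ ^ 2 - ‖T (geomOrbit T η x k)‖ ^ 2) := by
  have h := sum_re_inner_two_smul_sub_eq_energy (fun y => η • T y) x (geomOrbit T η x)
    (geomOrbit_zero T η x) (geomOrbit_succ T η x) n
  simp only [norm_smul, hη, one_mul] at h
  rw [← h, aeval_fejerPolynomial_apply, inner_sum, Complex.re_sum]
  rfl

/-- Comparison of the energies of the orbits of two contractions. -/
theorem re_inner_aeval_fejerPolynomial_le {T T' : H →L[ℂ] H} (hT : ‖T‖ ≤ 1)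
    (h1 : ∀ x, ‖x‖ ^ 2 - ‖T' x‖ ^ 2 ≤ 5 / 4 * (‖x‖ ^ 2 - ‖T x‖ ^ 2))
    (h2 : ∀ x y, ‖T' x + (T' - T) y‖ ^ 2 ≤
      ‖x‖ ^ 2 - 1 / 2 * (‖x‖ ^ 2 - ‖T x‖ ^ 2) + 1 / 4 * (‖y‖ ^ 2 - ‖T y‖ ^ 2))
    (n : ℕ) {η : ℂ} (hη : ‖η‖ = 1) (x : H) :
    (inner ℂ x (aeval T' (fejerPolynomial n η) x)).re ≤
      5 * (inner ℂ x (aeval T (fejerPolynomial n η) x)).re := by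
  rw [re_inner_aeval_fejerPolynomial T' n hη, re_inner_aeval_fejerPolynomial T n hη]
  set s := geomOrbit T η x
  set s' := geomOrbit T' η x
  set α : H → ℝ := fun y => ‖y‖ ^ 2 - ‖T y‖ ^ 2
  have hα : ∀ y, 0 ≤ α y := fun y => by
    have : ‖T y‖ ≤ ‖y‖ := by simpa using T.le_of_opNorm_le hT y
    exact sub_nonneg.2 (by gcongr)
  have hαadd : ∀ y z, α (y + z) ≤ 2 * α y + 2 * α z := fun y z => by
    have e1 := parallelogram_law_with_norm ℂ y z
    have e2 := parallelogram_law_with_norm ℂ (T y) (T z)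
    have e3 := hα (y - z)
    simp only [α, map_add, map_sub] at e3 ⊢
    nlinarith
  -- The difference of the orbits obeys a recursion driven by (T' - T) s_k, and `h2` telescopes
  -- along it.
  have herr : ∀ m, ‖s' m - s m‖ ^ 2 + 1 / 2 * ∑ k ∈ range m, α (s' k - s k) ≤
      1 / 4 * ∑ k ∈ range m, α (s k) := by
    intro m
    induction m with
    | zero => simp [s, s', geomOrbit_zero]
    | succ m ih =>
      have hrec : s' (m + 1) - s (m + 1) = η • (T' (s' m - s m) + (T' - T) (s m)) := by
        simp only [s, s', geomOrbit_succ, _root_.sub_apply, map_sub]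
        module
      have := h2 (s' m - s m) (s m)
      rw [sum_range_succ, sum_range_succ, hrec, norm_smul, hη, one_mul]
      simp only [α] at ih ⊢
      linarith
  have hsum : ∑ k ∈ range n, (‖s' k‖ ^ 2 - ‖T' (s' k)‖ ^ 2) ≤
      5 / 2 * ∑ k ∈ range n, α (s k) + 5 / 2 * ∑ k ∈ range n, α (s' k - s k) := by
    rw [mul_sum, mul_sum, ← sum_add_distrib]
    refine sum_le_sum fun k _ => ?_
    have e1 := h1 (s' k)
    have e2 := hαadd (s k) (s' k - s k)
    rw [add_sub_cancel] at e2
    simp only [α] at e2 ⊢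
    linarith
  have hnorm : ‖s' n‖ ^ 2 ≤ 2 * ‖s n‖ ^ 2 + 2 * ‖s' n - s n‖ ^ 2 := by
    have := parallelogram_law_with_norm ℂ (s n) (s' n - s n)
    rw [add_sub_cancel] at this
    nlinarith [sq_nonneg ‖s n - (s' n - s n)‖]
  have e1 := herr n
  have e2 : 0 ≤ ∑ k ∈ range n, α (s k) := sum_nonneg fun k _ => hα _
  change _ ≤ 5 * (‖s n‖ ^ 2 + ∑ k ∈ range n, α (s k))
  -- Five times `herr` absorbs the error terms, leaving at most 2‖s_n‖² + (15/4) ∑ α(s_k).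
  nlinarith [sq_nonneg ‖s' n - s n‖, sq_nonneg ‖s n‖]

/-! ### Fejér forms and Harnack domination -/

variable [CompleteSpace H]

theorem inner_realPart_apply_re (A : H →L[ℂ] H) (x : H) :
    (inner ℂ x ((ℜ A : H →L[ℂ] H) x)).re = (inner ℂ x (A x)).re := by
  have h1 : (inner ℂ x ((star A) x)).re = (inner ℂ x (A x)).re := by
    rw [ContinuousLinearMap.star_eq_adjoint, ContinuousLinearMap.adjoint_inner_right,
      ← inner_conj_symm, Complex.conj_re]
  rw [realPart_apply_coe, _root_.smul_apply, _root_.add_apply,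
    ← Complex.coe_smul, inner_smul_right, inner_add_right, Complex.re_ofReal_mul, Complex.add_re,
    h1]
  ring

theorem realPart_le_smul_realPart_iff (A B : H →L[ℂ] H) (c : ℝ) :
    (ℜ A : H →L[ℂ] H) ≤ c • (ℜ B : H →L[ℂ] H) ↔
      ∀ x, (inner ℂ x (A x)).re ≤ c * (inner ℂ x (B x)).re := by
  have key : ∀ x, (inner ℂ ((c • (ℜ B : H →L[ℂ] H) - (ℜ A : H →L[ℂ] H)) x) x).re =
      c * (inner ℂ x (B x)).re - (inner ℂ x (A x)).re := by
    intro x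
    rw [← inner_conj_symm, Complex.conj_re, _root_.sub_apply,
      _root_.smul_apply, inner_sub_right, ← Complex.coe_smul, inner_smul_right,
      Complex.sub_re, Complex.re_ofReal_mul, inner_realPart_apply_re, inner_realPart_apply_re]
  have hsa : IsSelfAdjoint (c • (ℜ B : H →L[ℂ] H) - (ℜ A : H →L[ℂ] H)) :=
    ((IsSelfAdjoint.all c).smul (ℜ B).2).sub (ℜ A).2
  rw [ContinuousLinearMap.le_def, ContinuousLinearMap.isPositive_def', and_iff_right hsa]
  refine forall_congr' fun x => ?_
  rw [ContinuousLinearMap.reApplyInnerSelf_apply]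
  change 0 ≤ (inner ℂ ((c • (ℜ B : H →L[ℂ] H) - (ℜ A : H →L[ℂ] H)) x) x).re ↔ _
  rw [key, sub_nonneg]

/-- A uniform inequality between Fejér forms implies Harnack domination. -/
theorem harnackDominated_of_fejerPolynomial_le {T T' : H →L[ℂ] H} {c : ℝ} (hc : 1 ≤ c)
    (h : ∀ (n : ℕ) (η : ℂ) (x : H), ‖η‖ = 1 →
      (inner ℂ x (aeval T (fejerPolynomial n η) x)).re ≤
        c * (inner ℂ x (aeval T' (fejerPolynomial n η) x)).re) :
    HarnackDominated T T' := by
  refine ⟨c, hc, fun p hp => (realPart_le_smul_realPart_iff _ _ _).2 fun x => ?_⟩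
  set d := p.natDegree
  have hval : ∀ S : H →L[ℂ] H, inner ℂ x (aeval S p x) =
      ∑ k ∈ range (d + 1), p.coeff k * inner ℂ x ((S ^ k) x) := by
    intro S
    rw [Polynomial.aeval_eq_sum_range, _root_.sum_apply, inner_sum]
    exact sum_congr rfl fun k _ => by
      rw [_root_.smul_apply, inner_smul_right]
  set Y : (H →L[ℂ] H) → ℝ := fun S =>
    (∑ k ∈ range (d + 1), p.coeff k * ((1 - k) * inner ℂ x ((S ^ k) x))).re
  have hsplit : ∀ (S : H →L[ℂ] H) (n : ℕ),
      (∑ k ∈ range (d + 1), p.coeff k * (((n : ℂ) + 1 - k) * inner ℂ x ((S ^ k) x))).re =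
        n * (inner ℂ x (aeval S p x)).re + Y S := by
    intro S n
    rw [hval S, ← Complex.re_ofReal_mul, ← Complex.add_re, mul_sum, ← sum_add_distrib]
    congr 1
    refine sum_congr rfl fun k _ => ?_
    push_cast
    ring
  rw [← sub_nonneg]
  -- The averaged inequality is affine in n; its slope is the inequality sought for p.
  refine nonneg_of_forall_natCast_mul_add_nonneg (y := c * Y T' - Y T) (d := d) fun n hn => ?_
  set N := d + n + 1
  have hζ := Complex.isPrimitiveRoot_exp N (by omega)
  set ζ := Complex.exp (2 * Real.pi * Complex.I / N)
  have havg : ∀ S : H →L[ℂ] H, ∑ i ∈ range N, (p.eval (ζ ^ i)).re *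
      (inner ℂ x (aeval S (fejerPolynomial n (ζ ^ i)⁻¹) x)).re =
        N * (n * (inner ℂ x (aeval S p x)).re + Y S) := by
    intro S
    rw [← hsplit]
    simp_rw [inner_aeval_fejerPolynomial]
    refine hζ.sum_re_eval_mul_re_fejer p hn (by omega) (fun j => inner ℂ x ((S ^ j) x)) ?_
    simpa using inner_self_im (𝕜 := ℂ) x
  have hnorm : ∀ i, ‖ζ ^ i‖ = 1 := by
    intro i
    rw [norm_pow, hζ.norm'_eq_one (by omega), one_pow]
  have hle : (N : ℝ) * (n * (inner ℂ x (aeval T p x)).re + Y T) ≤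
      N * (c * (n * (inner ℂ x (aeval T' p x)).re + Y T')) := by
    rw [mul_left_comm, ← havg, ← havg, mul_sum]
    refine sum_le_sum fun i _ => ?_
    rw [mul_left_comm]
    exact mul_le_mul_of_nonneg_left (h n _ x (by rw [norm_inv, hnorm, inv_one]))
      (hp _ (hnorm i).le)
  have := le_of_mul_le_mul_left hle (by positivity)
  linarith

/-- Harnack domination implies domination of the two-by-two Toeplitz forms. -/
theorem HarnackDominated.toeplitz_two_le {T T' : H →L[ℂ] H} (h : HarnackDominated T T') :
    ∃ c : ℝ, ∀ x y : H, ‖x‖ ^ 2 + ‖y‖ ^ 2 + 2 * (inner ℂ x (T y)).re ≤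
      c * (‖x‖ ^ 2 + ‖y‖ ^ 2 + 2 * (inner ℂ x (T' y)).re) := by
  obtain ⟨c, -, hc⟩ := h
  refine ⟨c, fun x y => ?_⟩
  rw [← sub_nonneg]
  refine nonneg_of_forall_natCast_mul_add_nonneg
    (y := c * (‖x‖ ^ 2 + ‖y‖ ^ 2) - (‖x‖ ^ 2 + ‖y‖ ^ 2)) (d := 1) fun n hn => ?_
  set N := n + 2
  have hζ := Complex.isPrimitiveRoot_exp N (by omega)
  set ζ := Complex.exp (2 * Real.pi * Complex.I / N)
  have hnorm : ∀ i, ‖ζ ^ i‖ = 1 := by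
    intro i
    rw [norm_pow, hζ.norm'_eq_one (by omega), one_pow]
  have hself : ∀ z : H, (inner ℂ z z).re = ‖z‖ ^ 2 := fun z => by
    simpa using inner_self_eq_norm_sq (𝕜 := ℂ) z
  -- The twist by ζ^i selects the first power of S in ⟨x, · y⟩ and annihilates ⟨y, · x⟩.
  have havg : ∀ S : H →L[ℂ] H, ∑ i ∈ range N,
      (inner ℂ (x + ζ ^ i • y) (aeval S (fejerPolynomial n (ζ ^ i)⁻¹) (x + ζ ^ i • y))).re =
        N * ((n + 1) * (‖x‖ ^ 2 + ‖y‖ ^ 2) + n * (2 * (inner ℂ x (S y)).re)) := by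
    intro S
    have hexp : ∀ i, inner ℂ (x + ζ ^ i • y)
        (aeval S (fejerPolynomial n (ζ ^ i)⁻¹) (x + ζ ^ i • y)) =
        (ζ ^ i) ^ 0 * inner ℂ x (aeval S (fejerPolynomial n (ζ ^ i)⁻¹) x) +
        (ζ ^ i) ^ 1 * inner ℂ x (aeval S (fejerPolynomial n (ζ ^ i)⁻¹) y) +
        ((ζ ^ i)⁻¹ ^ 1 * inner ℂ y (aeval S (fejerPolynomial n (ζ ^ i)⁻¹) x) +
        (ζ ^ i) ^ 0 * inner ℂ y (aeval S (fejerPolynomial n (ζ ^ i)⁻¹) y)) := by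
      intro i
      have h0 : ζ ^ i ≠ 0 := by
        rw [← norm_ne_zero_iff, hnorm]
        exact one_ne_zero
      rw [map_add, map_smul, inner_add_left, inner_add_right, inner_add_right, inner_smul_left,
        inner_smul_left, inner_smul_right, inner_smul_right,
        Complex.conj_eq_inv_of_norm_eq_one (hnorm i)]
      field_simp
    rw [← Complex.re_sum]
    simp_rw [hexp, sum_add_distrib, inner_aeval_fejerPolynomial]
    rw [hζ.sum_pow_mul_fejer (Nat.zero_le n) (by omega) (fun j => inner ℂ x ((S ^ j) x)),
      hζ.sum_pow_mul_fejer hn (by omega) (fun j => inner ℂ x ((S ^ j) y)),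
      hζ.sum_inv_pow_mul_fejer (by omega) (fun j => inner ℂ y ((S ^ j) x)),
      hζ.sum_pow_mul_fejer (Nat.zero_le n) (by omega) (fun j => inner ℂ y ((S ^ j) y))]
    have e1 : (N : ℂ) * (fejerCoeff n 0 * inner ℂ x ((S ^ 0) x)) =
        ((N * (n + 1) : ℝ) : ℂ) * inner ℂ x x := by simp [fejerCoeff, mul_assoc]
    have e2 : (N : ℂ) * (fejerCoeff n 1 * inner ℂ x ((S ^ 1) y)) =
        ((N * (2 * n) : ℝ) : ℂ) * inner ℂ x (S y) := by simp [fejerCoeff, mul_assoc]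
    have e3 : (N : ℂ) * (fejerCoeff n 0 * inner ℂ y ((S ^ 0) y)) =
        ((N * (n + 1) : ℝ) : ℂ) * inner ℂ y y := by simp [fejerCoeff, mul_assoc]
    rw [e1, e2, e3, if_neg one_ne_zero]
    simp only [Complex.add_re, Complex.re_ofReal_mul, hself, Complex.zero_re]
    ring
  have hle : (N : ℝ) * ((n + 1) * (‖x‖ ^ 2 + ‖y‖ ^ 2) + n * (2 * (inner ℂ x (T y)).re)) ≤
      N * (c * ((n + 1) * (‖x‖ ^ 2 + ‖y‖ ^ 2) + n * (2 * (inner ℂ x (T' y)).re))) := by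
    rw [mul_left_comm (N : ℝ) c, ← havg, ← havg, mul_sum]
    refine sum_le_sum fun i _ => ?_
    exact (realPart_le_smul_realPart_iff _ _ _).1 (hc _ fun z hz =>
      eval_fejerPolynomial_re_nonneg n (by rw [norm_inv, hnorm, inv_one]) hz) _
  have := le_of_mul_le_mul_left hle (by positivity)
  linarith

/-! ### Rigidity below isometries and coisometries -/

/-- At (T'x, -x) the form of T' vanishes, while that of T is at least ‖T'x - Tx‖². The coisometric
case uses (x, -T'*x). -/
theorem HarnackDominated.eq_of_isometry {T T' : H →L[ℂ] H} (h : HarnackDominated T T')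
    (hT : ‖T‖ ≤ 1) (hT' : Isometry T') : T = T' := by
  obtain ⟨c, hc⟩ := h.toeplitz_two_le
  ext x
  have hiso : ‖T' x‖ = ‖x‖ := (AddMonoidHomClass.isometry_iff_norm T').1 hT' x
  have h1 := hc (T' x) (-x)
  have hself : (inner ℂ (T' x) (T' x)).re = ‖T' x‖ ^ 2 := by
    simpa using inner_self_eq_norm_sq (𝕜 := ℂ) (T' x)
  simp only [map_neg, inner_neg_right, Complex.neg_re, norm_neg, hself, hiso] at h1
  have h2 := norm_sub_sq (𝕜 := ℂ) (T' x) (T x)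
  have h3 : ‖T x‖ ≤ ‖x‖ := by simpa using T.le_of_opNorm_le hT x
  have h4 : ‖T x‖ ^ 2 ≤ ‖x‖ ^ 2 := by gcongr
  rw [hiso, RCLike.re_eq_complex_re] at h2
  have h5 : ‖T' x - T x‖ ^ 2 ≤ 0 := by linarith
  have h6 : ‖T' x - T x‖ = 0 := by nlinarith [norm_nonneg (T' x - T x)]
  exact (sub_eq_zero.1 (norm_eq_zero.1 h6)).symm

theorem HarnackDominated.eq_of_isometry_adjoint {T T' : H →L[ℂ] H} (h : HarnackDominated T T')
    (hT : ‖T‖ ≤ 1) (hT' : Isometry (ContinuousLinearMap.adjoint T')) : T = T' := by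
  obtain ⟨c, hc⟩ := h.toeplitz_two_le
  apply ContinuousLinearMap.adjoint.injective
  ext x
  set S := ContinuousLinearMap.adjoint T
  set S' := ContinuousLinearMap.adjoint T'
  have hiso : ‖S' x‖ = ‖x‖ := (AddMonoidHomClass.isometry_iff_norm S').1 hT' x
  have h1 := hc x (-S' x)
  have hself : (inner ℂ (S' x) (S' x)).re = ‖S' x‖ ^ 2 := by
    simpa using inner_self_eq_norm_sq (𝕜 := ℂ) (S' x)
  simp only [map_neg, inner_neg_right, Complex.neg_re, norm_neg] at h1
  rw [← ContinuousLinearMap.adjoint_inner_left T, ← ContinuousLinearMap.adjoint_inner_left T']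
    at h1
  change _ + _ + 2 * -(inner ℂ (S x) (S' x)).re ≤ c * (_ + _ + 2 * -(inner ℂ (S' x) (S' x)).re)
    at h1
  rw [hself, hiso] at h1
  have h2 := norm_sub_sq (𝕜 := ℂ) (S x) (S' x)
  have h3 : ‖S x‖ ≤ ‖x‖ := by
    simpa using S.le_of_opNorm_le ((LinearIsometryEquiv.norm_map _ T).trans_le hT) x
  have h4 : ‖S x‖ ^ 2 ≤ ‖x‖ ^ 2 := by gcongr
  rw [hiso, RCLike.re_eq_complex_re] at h2
  have h5 : ‖S x - S' x‖ ^ 2 ≤ 0 := by linarith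
  have h6 : ‖S x - S' x‖ = 0 := by nlinarith [norm_nonneg (S x - S' x)]
  exact sub_eq_zero.1 (norm_eq_zero.1 h6)

/-! ### Perturbation through the defect operators -/

/-- This is D² ≤ D for D = 1 - T*T, as 0 ≤ D ≤ 1. -/
theorem norm_sub_adjoint_apply_sq_le {T : H →L[ℂ] H} (hT : ‖T‖ ≤ 1) (x : H) :
    ‖x - ContinuousLinearMap.adjoint T (T x)‖ ^ 2 ≤ ‖x‖ ^ 2 - ‖T x‖ ^ 2 := by
  have h1 := norm_sub_sq (𝕜 := ℂ) x (ContinuousLinearMap.adjoint T (T x))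
  have hself : (inner ℂ (T x) (T x)).re = ‖T x‖ ^ 2 := by
    simpa using inner_self_eq_norm_sq (𝕜 := ℂ) (T x)
  rw [ContinuousLinearMap.adjoint_inner_right, RCLike.re_eq_complex_re, hself] at h1
  have h2 : ‖ContinuousLinearMap.adjoint T (T x)‖ ≤ ‖T x‖ := by
    simpa using (ContinuousLinearMap.adjoint T).le_of_opNorm_le
      ((LinearIsometryEquiv.norm_map _ T).trans_le hT) (T x)
  have h3 : ‖ContinuousLinearMap.adjoint T (T x)‖ ^ 2 ≤ ‖T x‖ ^ 2 := by gcongr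
  linarith

theorem exists_sub_adjoint_apply_ne_zero {T : H →L[ℂ] H} (hT : ¬ Isometry T) :
    ∃ x, x - ContinuousLinearMap.adjoint T (T x) ≠ 0 := by
  contrapose! hT
  refine AddMonoidHomClass.isometry_of_norm T fun x => ?_
  have h : (inner ℂ x (ContinuousLinearMap.adjoint T (T x))).re = ‖T x‖ ^ 2 := by
    rw [ContinuousLinearMap.adjoint_inner_right]
    simpa using inner_self_eq_norm_sq (𝕜 := ℂ) (T x)
  rw [← sub_eq_zero.1 (hT x)] at h
  have hself : (inner ℂ x x).re = ‖x‖ ^ 2 := by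
    simpa using inner_self_eq_norm_sq (𝕜 := ℂ) x
  rw [hself] at h
  exact ((sq_eq_sq₀ (norm_nonneg _) (norm_nonneg _)).1 h).symm

/-- Estimates for the perturbation `T + (1 - T T*) X (1 - T* T)` of a contraction `T`. -/
theorem defect_perturbation_estimates {T T' X : H →L[ℂ] H} (hT : ‖T‖ ≤ 1) (hX : ‖X‖ ≤ 1 / 12)
    (hT' : ∀ x, T' x = T x + (X (x - ContinuousLinearMap.adjoint T (T x)) -
      T (ContinuousLinearMap.adjoint T (X (x - ContinuousLinearMap.adjoint T (T x)))))) :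
    (∀ x, ‖x‖ ^ 2 - ‖T' x‖ ^ 2 ≤ 5 / 4 * (‖x‖ ^ 2 - ‖T x‖ ^ 2)) ∧
    (∀ x y, ‖T' x + (T' - T) y‖ ^ 2 ≤
      ‖x‖ ^ 2 - 1 / 2 * (‖x‖ ^ 2 - ‖T x‖ ^ 2) + 1 / 4 * (‖y‖ ^ 2 - ‖T y‖ ^ 2)) := by
  set Ta := ContinuousLinearMap.adjoint T
  have hTa : ‖Ta‖ ≤ 1 := (LinearIsometryEquiv.norm_map _ T).trans_le hT
  set A : H → H := fun x => x - Ta (T x)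
  set G : H → H := fun x => X (A x) - T (Ta (X (A x)))
  have hA : ∀ x, ‖A x‖ ^ 2 ≤ ‖x‖ ^ 2 - ‖T x‖ ^ 2 := norm_sub_adjoint_apply_sq_le hT
  have hXA : ∀ x, ‖X (A x)‖ ≤ 1 / 12 * ‖A x‖ := fun x => X.le_of_opNorm_le hX _
  have hG : ∀ x, ‖G x‖ ≤ 1 / 12 * ‖A x‖ := fun x => by
    refine le_trans ?_ (hXA x)
    have h := norm_sub_adjoint_apply_sq_le hTa (X (A x))
    rw [ContinuousLinearMap.adjoint_adjoint] at h
    exact pow_le_pow_iff_left₀ (norm_nonneg _) (norm_nonneg _) two_ne_zero |>.1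
      (h.trans (sub_le_self _ (sq_nonneg _)))
  -- Since T*(1 - TT*) = (1 - T*T)T*, the cross term is controlled by the defects of both x and y.
  have hTG : ∀ x y, |(inner ℂ (T x) (G y)).re| ≤ 1 / 12 * (‖A x‖ * ‖A y‖) := fun x y => by
    have e : inner ℂ (T x) (G y) = inner ℂ (T (A x)) (X (A y)) := by
      change inner ℂ (T x) (X (A y) - T (Ta (X (A y)))) = inner ℂ (T (x - Ta (T x))) (X (A y))
      rw [inner_sub_right, map_sub T, inner_sub_left, ← ContinuousLinearMap.adjoint_inner_left T,
        ContinuousLinearMap.adjoint_inner_right T]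
    rw [e]
    have e1 : ‖T (A x)‖ ≤ ‖A x‖ := by simpa using T.le_of_opNorm_le hT (A x)
    calc _ ≤ ‖inner ℂ (T (A x)) (X (A y))‖ := Complex.abs_re_le_norm _
      _ ≤ ‖T (A x)‖ * ‖X (A y)‖ := norm_inner_le_norm _ _
      _ ≤ ‖A x‖ * (1 / 12 * ‖A y‖) := by gcongr; exact hXA y
      _ = _ := by ring
  have hGG : ∀ x y, |(inner ℂ (G x) (G y)).re| ≤ 1 / 144 * (‖A x‖ * ‖A y‖) := fun x y => by
    calc _ ≤ ‖inner ℂ (G x) (G y)‖ := Complex.abs_re_le_norm _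
      _ ≤ ‖G x‖ * ‖G y‖ := norm_inner_le_norm _ _
      _ ≤ (1 / 12 * ‖A x‖) * (1 / 12 * ‖A y‖) := by
          gcongr
          exacts [hG x, hG y]
      _ = _ := by ring
  have hT'' : ∀ x, T' x = T x + G x := hT'
  have hsq : ∀ x, ‖T' x‖ ^ 2 = ‖T x‖ ^ 2 + 2 * (inner ℂ (T x) (G x)).re + ‖G x‖ ^ 2 := fun x => by
    rw [hT'']
    exact norm_add_sq (𝕜 := ℂ) _ _
  have hGsq : ∀ x, ‖G x‖ ^ 2 ≤ 1 / 144 * ‖A x‖ ^ 2 := fun x => by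
    calc ‖G x‖ ^ 2 ≤ (1 / 12 * ‖A x‖) ^ 2 := by gcongr; exact hG x
      _ = _ := by ring
  constructor
  · intro x
    have e1 := (abs_le.1 (hTG x x)).1
    rw [hsq]
    nlinarith [hA x, sq_nonneg ‖G x‖]
  · intro x y
    have e0 : (T' - T) y = G y := by
      rw [_root_.sub_apply, hT'', add_sub_cancel_left]
    have e1 := norm_add_sq (𝕜 := ℂ) (T' x) (G y)
    have e2 : (inner ℂ (T' x) (G y)).re =
        (inner ℂ (T x) (G y)).re + (inner ℂ (G x) (G y)).re := by
      rw [hT'', inner_add_left, Complex.add_re]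
    rw [RCLike.re_eq_complex_re, e2, hsq] at e1
    rw [e0, e1]
    have e3 := (abs_le.1 (hTG x x)).2
    have e4 := (abs_le.1 (hTG x y)).2
    have e5 := (abs_le.1 (hGG x y)).2
    have e6 := hGsq x
    have e7 := hGsq y
    have e8 := hA x
    have e9 := hA y
    have e10 := sq_nonneg (‖A x‖ - ‖A y‖)
    -- By `e10` the coefficients of ‖A x‖² and ‖A y‖² are at most 38/144 < 1/2 and 14/144 < 1/4.
    nlinarith

/-- X sends a = (1 - T*T)v ≠ 0 to a nonzero multiple of u, which 1 - TT* does not kill; hence T'v ≠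
Tv. -/
theorem IsHarnackMinimal.isometry_or_isometry_adjoint {T : H →L[ℂ] H} (hT : ‖T‖ ≤ 1)
    (h : IsHarnackMinimal T) : Isometry T ∨ Isometry (ContinuousLinearMap.adjoint T) := by
  by_contra! hcon
  obtain ⟨v, hv⟩ := exists_sub_adjoint_apply_ne_zero hcon.1
  obtain ⟨u, hu⟩ := exists_sub_adjoint_apply_ne_zero hcon.2
  rw [ContinuousLinearMap.adjoint_adjoint] at hu
  set Ta := ContinuousLinearMap.adjoint T
  set a := v - Ta (T v)
  set R : H →L[ℂ] H := InnerProductSpace.rankOne ℂ u a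
  set δ : ℝ := 1 / (12 * (‖R‖ + 1))
  have hδ : 0 < δ := by positivity
  set X : H →L[ℂ] H := (δ : ℂ) • R
  have hX : ‖X‖ ≤ 1 / 12 := by
    rw [norm_smul, Complex.norm_real, Real.norm_of_nonneg hδ.le]
    have : ‖R‖ ≤ ‖R‖ + 1 := by linarith
    calc δ * ‖R‖ ≤ δ * (‖R‖ + 1) := by gcongr
      _ = 1 / 12 := by simp only [δ]; field_simp
  set T' : H →L[ℂ] H := T + (1 - T * Ta) * X * (1 - Ta * T)
  have hT' : ∀ x, T' x = T x + (X (x - Ta (T x)) - T (Ta (X (x - Ta (T x))))) := fun x => rfl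
  obtain ⟨h1, h2⟩ := defect_perturbation_estimates hT hX hT'
  have hcontr : ‖T'‖ ≤ 1 := by
    refine T'.opNorm_le_bound zero_le_one fun x => ?_
    -- The case y = 0 of the second estimate gives contractivity.
    have e1 := h2 x 0
    have e2 : ‖T x‖ ≤ ‖x‖ := by simpa using T.le_of_opNorm_le hT x
    have e3 : ‖T x‖ ^ 2 ≤ ‖x‖ ^ 2 := by gcongr
    simp only [map_zero, add_zero, norm_zero] at e1
    rw [one_mul]
    exact pow_le_pow_iff_left₀ (norm_nonneg _) (norm_nonneg _) two_ne_zero |>.1 (by linarith)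
  have hdom : HarnackDominated T' T :=
    harnackDominated_of_fejerPolynomial_le (c := 5) (by norm_num) fun n η x hη =>
      re_inner_aeval_fejerPolynomial_le hT h1 h2 n hη x
  have heq := hT' v
  rw [h T' hcontr hdom, left_eq_add] at heq
  have hXa : X a = ((δ : ℂ) * inner ℂ a a) • u := by
    simp [X, R, mul_smul]
  change X a - T (Ta (X a)) = 0 at heq
  rw [hXa, map_smul, map_smul, ← smul_sub, smul_eq_zero, mul_eq_zero] at heq
  rcases heq with (heq | heq) | heq
  · exact hδ.ne' (Complex.ofReal_eq_zero.1 heq)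
  · exact hv (inner_self_eq_zero.1 heq)
  · exact hu heq

end Hilbert

theorem mainTheorem2 {H : Type*} [NormedAddCommGroup H] [InnerProductSpace ℂ H]
    [CompleteSpace H] :
    (∀ T : H →L[ℂ] H, ‖T‖ ≤ 1 →
      (IsHarnackMinimal T ↔ Isometry T ∨ Isometry (ContinuousLinearMap.adjoint T))) ∧
    (∀ T T' : H →L[ℂ] H, ‖T‖ ≤ 1 → Isometry T' → HarnackDominated T T' → T = T') := by
  refine ⟨fun T hT => ⟨fun h => h.isometry_or_isometry_adjoint hT, ?_⟩,
    fun T T' hT hT' h => h.eq_of_isometry hT hT'⟩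
  rintro (h | h) T' hT' hdom
  · exact hdom.eq_of_isometry hT' h
  · exact hdom.eq_of_isometry_adjoint hT' h
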